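/- Let $\mathrm{TT}^1_2$ be the problem whose inputs are the colourings $c : 2^{<\omega} \to \{0,1\}$ of the full binary tree and whose solutions for $c$ are the sets $H \subseteq 2^{<\omega}$ on which $c$ is constant and which are isomorphic copies of the full binary tree. Here the tree is viewed either as a partial order under the prefix relation, or as a structure with the two relations "is in the left subtree below" and "is in the right subtree below"; the claim holds for both readings. Colourings are named by their tables of values and subsets of $2^{<\omega}$ by their characteristic functions. The first-order part $^1(f)$ of a problem $f$ is the greatest Weihrauch degree among those that are reducible to $f$ and have a representative with codomain $\mathbb{N}$. For $k \in \mathbb{N}$, a partial multivalued function $f : \mathbf{X} \rightrightarrows \mathbf{Y}$ between represented spaces is called $k$-guessable if the multivalued map $\breve{f}_k : \mathbf{X} \rightrightarrows \overline{\mathbf{Y}}^k$ with the same domain as $f$ and with $(y_0,\ldots,y_{k-1}) \in \breve{f}_k(x)$ iff $y_i \in f(x)$ for some $i < k$ is computable. Here $\overline{\mathbf{Y}}$ is the completion of $\mathbf{Y}$: the set $\mathbf{Y} \cup \{\bot\}$ in which $p \in \mathbb{N}^\mathbb{N}$ is a name of $y \in \mathbf{Y}$ if deleting all zeros from $p$ and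 decreasing the remaining entries by one gives an infinite sequence that is a name of $y$, and a name of $\bot$ otherwise. Then $^1(\mathrm{TT}^1_2)$ exists, and for no $k \in \mathbb{N}$ is $^1(\mathrm{TT}^1_2)$ $k$-guessable, i.e. no problem representing this degree is $k$-guessable. -/

import Mathlib

namespace Weihrauch

/-! ### Computable functions on Baire space -/

/-- Baire space, the set of names. -/
abbrev Baire : Type := ℕ → ℕ

/-- The finite prefix `p(0), …, p(n-1)` of `p`. -/
def take (p : Baire) (n : ℕ) : List ℕ := (List.range n).map p

/-- A type-two machine, given by a computable word function that is monotone for the prefix order: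
`step w` is the output that is known after the prefix `w` of the input has been read. -/
structure Machine where
  step : List ℕ → List ℕ
  computable_step : Computable step
  mono : ∀ v w, v <+: w → step v <+: step w

/-- On input `p` the machine writes the infinite sequence `q`. The partial functions
`p ↦ q` that arise in this way (and their restrictions) are the computable partial functions
on Baire space. For given `p` there is at most one such `q`. -/
def Machine.Outputs (M : Machine) (p q : Baire) : Prop :=
  ∀ n, ∃ m, take q n <+: M.step (take p m)

/-- The pairing `⟨p, q⟩` of points of Baire space. -/
def join (p q : Baire) : Baire := fun n => if n % 2 = 0 then p (n / 2) else q (n / 2)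

/-! ### Represented spaces -/

/-- A represented space: a set together with a partial surjection from Baire space onto it. -/
structure RepresentedSpace where
  carrier : Type
  rep : Baire →. carrier
  surj : ∀ x, ∃ p, x ∈ rep p

/-- The natural numbers; `p` is a name of `p 0`. -/
def natSpace : RepresentedSpace where
  carrier := ℕ
  rep p := Part.some (p 0)
  surj n := ⟨fun _ => n, by simp⟩

/-- The sequence `p - 1`, which arises from `p` by deleting all zeros and decreasing the other
entries by one. It is meaningful if `p` has infinitely many nonzero entries. -/
noncomputable def strip (p : Baire) : Baire := fun n => p (Nat.nth (fun i => p i ≠ 0) n) - 1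

theorem strip_succ (q : Baire) : strip (fun n => q n + 1) = q := by
  funext n
  have h : ∀ i, Nat.nth (fun _ : ℕ => True) i = i := fun i => by
    simp
  simp [strip, h]

open Classical in
/-- The completion of a represented space `Y`: a point `⊥` is added, and the representation is the
total one under which `p` is a name of `y` if `p - 1` is an infinite sequence and a name of `y`
in `Y`, and a name of `⊥` in all other cases. -/
noncomputable def completion (Y : RepresentedSpace) : RepresentedSpace where
  carrier := WithBot Y.carrier
  rep p := Part.some
    (if h : {i | p i ≠ 0}.Infinite ∧ (Y.rep (strip p)).Dom then
      (((Y.rep (strip p)).get h.2 : Y.carrier) : WithBot Y.carrier) else ⊥)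
  surj y := by
    induction y using WithBot.recBotCoe with
    | bot => exact ⟨fun _ => 0, by simp⟩
    | coe y =>
      obtain ⟨q, hq⟩ := Y.surj y
      refine ⟨fun n => q n + 1, ?_⟩
      have h : {i : ℕ | (fun n => q n + 1) i ≠ 0}.Infinite ∧
          (Y.rep (strip (fun n => q n + 1))).Dom := by
        rw [strip_succ]
        exact ⟨by simpa using Set.infinite_univ, hq.1⟩
      rw [dif_pos h, Part.mem_some_iff, WithBot.coe_inj]
      simp only [strip_succ]
      exact (Part.get_eq_of_mem hq _).symm

/-- The power `Y^k`; the `i`-th component of the tuple named by `p` has the name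
`n ↦ p (Nat.pair i n)`. -/
def power (Y : RepresentedSpace) (k : ℕ) : RepresentedSpace where
  carrier := Fin k → Y.carrier
  rep p := ⟨∀ i : Fin k, (Y.rep fun n => p (Nat.pair i n)).Dom, fun h i => (Y.rep _).get (h i)⟩
  surj y := by
    choose q hq using fun i => Y.surj (y i)
    let P : Baire := fun m => if h : m.unpair.1 < k then q ⟨_, h⟩ m.unpair.2 else 0
    have h : ∀ i : Fin k, y i ∈ Y.rep fun n => P (Nat.pair i n) := by
      intro i
      simpa [P] using hq i
    exact ⟨P, fun i => (h i).1, funext fun i => Part.get_eq_of_mem (h i) (h i).1⟩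

/-- The space of colourings `2^{<ω} → {0, …, k-1}`, named by their tables of values. -/
def colourings (k : ℕ) : RepresentedSpace where
  carrier := List Bool → Fin k
  rep p := ⟨∀ σ : List Bool, p (Encodable.encode σ) < k, fun h σ => ⟨p (Encodable.encode σ), h σ⟩⟩
  surj c := by
    refine ⟨fun n => ((Encodable.decode (α := List Bool) n).elim 0 fun σ => (c σ : ℕ)), ?_, ?_⟩
    · intro σ
      simp
    · funext σ
      simp

/-- The space of subsets of `2^{<ω}`, named by their characteristic functions. -/
def subsets : RepresentedSpace where
  carrier := Set (List Bool)
  rep p := ⟨∀ σ : List Bool, p (Encodable.encode σ) < 2,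
    fun _ => {σ | p (Encodable.encode σ) = 1}⟩
  surj H := by
    classical
    refine ⟨fun n => ((Encodable.decode (α := List Bool) n).elim 0
      fun σ => if σ ∈ H then 1 else 0), ?_, ?_⟩
    · intro σ
      by_cases h : σ ∈ H <;> simp [h]
    · ext σ
      by_cases h : σ ∈ H <;> simp [h]

/-! ### Problems and Weihrauch reducibility -/

/-- A problem, i.e. a partial multivalued function `X ⇉ Y`, given by its sets of solutions. -/
def Problem (X Y : RepresentedSpace) : Type := X.carrier → Set Y.carrier

/-- The domain of a problem: the inputs that have a solution. -/
def Problem.dom {X Y : RepresentedSpace} (f : Problem X Y) : Set X.carrier := {x | (f x).Nonempty}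

/-- Weihrauch reducibility `f ≤_W g`, with inner reduction witness `K` and outer reduction
witness `H`. -/
def Reducible {X Y Z W : RepresentedSpace} (f : Problem X Y) (g : Problem Z W) : Prop :=
  ∃ K H : Machine, ∀ p, ∀ x ∈ X.rep p, x ∈ f.dom →
    ∃ r, K.Outputs p r ∧ ∃ z ∈ Z.rep r, z ∈ g.dom ∧
      ∀ s, ∀ w ∈ W.rep s, w ∈ g z →
        ∃ q, H.Outputs (join p s) q ∧ ∃ y ∈ Y.rep q, y ∈ f x

/-- `d` is a representative of the first-order part of `f`: its degree is the greatest one among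
the Weihrauch degrees that are reducible to `f` and have a representative with codomain `ℕ`. -/
def IsFirstOrderPart {X Y Z W : RepresentedSpace} (d : Problem X Y) (f : Problem Z W) : Prop :=
  Reducible d f ∧
  (∃ (V : RepresentedSpace) (h : Problem V natSpace), Reducible d h ∧ Reducible h d) ∧
  ∀ (V : RepresentedSpace) (h : Problem V natSpace), Reducible h f → Reducible h d

/-! ### Guessability -/

/-- Some machine maps every name of every `x ∈ D` to a name of an element of `f x`. -/
def ComputableOn {X Y : RepresentedSpace} (D : Set X.carrier) (f : Problem X Y) : Prop :=
  ∃ M : Machine, ∀ p, ∀ x ∈ X.rep p, x ∈ D →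
    ∃ q, M.Outputs p q ∧ ∃ y ∈ Y.rep q, y ∈ f x

/-- The problem of producing `k` guesses in the completion of `Y`, at least one of which is a
solution of `f`. -/
def guesses {X Y : RepresentedSpace} (k : ℕ) (f : Problem X Y) :
    Problem X (power (completion Y) k) :=
  fun x => {y : Fin k → WithBot Y.carrier | ∃ i, ∃ v ∈ f x, y i = (v : WithBot Y.carrier)}

/-- `f` is `k`-guessable. -/
def Guessable {X Y : RepresentedSpace} (k : ℕ) (f : Problem X Y) : Prop :=
  ComputableOn f.dom (guesses k f)

/-! ### The tree pigeonhole principle -/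

/-- The two ways to see the full binary tree as a relational structure: with the prefix order,
or with the relations "in the left subtree below" and "in the right subtree below". -/
inductive TreeLanguage
  | order
  | leftRight

/-- `H ⊆ 2^{<ω}` is an isomorphic copy of the full binary tree: it is the range of an embedding
for the relations of the language. -/
def IsTreeCopy : TreeLanguage → Set (List Bool) → Prop
  | .order, H => ∃ e : List Bool → List Bool, Function.Injective e ∧ Set.range e = H ∧
      ∀ σ τ, e σ <+: e τ ↔ σ <+: τ
  | .leftRight, H => ∃ e : List Bool → List Bool, Function.Injective e ∧ Set.range e = H ∧
      ∀ (b : Bool) (σ τ), e σ ++ [b] <+: e τ ↔ σ ++ [b] <+: τ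

/-- The problem `TT¹_k`: given a colouring `c : 2^{<ω} → {0, …, k-1}`, find a monochromatic copy
of the full binary tree. -/
def TT (L : TreeLanguage) (k : ℕ) : Problem (colourings k) subsets :=
  fun (c : List Bool → Fin k) =>
    {H : Set (List Bool) | IsTreeCopy L H ∧ ∃ i : Fin k, ∀ σ ∈ H, c σ = i}

end Weihrauch

/-! Existence holds for every problem `f`. If a problem with codomain ℕ reduces to `f`, the outer
witness commits to its answer after a finite prefix of the solution's name, so its behaviour can be
stored in a table on words. The problem `firstOrder f`, whose inputs are a name of an instance of
`f` together with such a table, is therefore greatest (`reducible_firstOrder`,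
`firstOrder_reducible`).

For the lower bound, `antichainProblem N` asks for a colour and N pairwise incomparable strings,
each with infinitely many extensions of that colour. Any N incomparable points of a monochromatic
copy are an answer, so this problem lies below `TT L 2` and hence below its first-order part. Since
k-guessability passes down to problems with codomain ℕ (`Guessable.of_reducible`), it is enough that
`antichainProblem N` is not k-guessable when k ≤ N.

This is a diagonalisation. Suppose some of the k guesses are already fixed by a finite part of the
colouring. At most N antichains of size N have incomparable representatives
(`exists_incomparable_representatives`), so the colouring can be continued with the wrong colour
above one point of each guess (`exists_colouring_avoiding`). A correct guess must then come from a
new component, and after k + 1 rounds the components run out. -/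

namespace Weihrauch

/-! ### Finite prefixes of names and the entries of a machine's output -/

@[simp] theorem length_take (p : Baire) (n : ℕ) : (take p n).length = n := by simp [take]

theorem getElem?_take (p : Baire) (n i : ℕ) :
    (take p n)[i]? = if i < n then some (p i) else none := by
  by_cases h : i < n <;> simp [take, h]

theorem take_succ (p : Baire) (n : ℕ) : take p (n + 1) = take p n ++ [p n] := by
  simp [take, List.range_succ]

theorem take_take (p : Baire) {i n : ℕ} (h : i ≤ n) : (take p n).take i = take p i := by
  apply List.ext_getElem?
  intro j
  simp only [List.getElem?_take, getElem?_take]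
  grind

theorem take_prefix_take (p : Baire) {m n : ℕ} (h : m ≤ n) : take p m <+: take p n := by
  rw [← take_take p h]
  exact List.take_prefix _ _

theorem prefix_take_iff {l : List ℕ} {p : Baire} :
    (∃ n, l <+: take p n) ↔ l = take p l.length := by
  constructor
  · rintro ⟨n, h⟩
    have hl : l.length ≤ n := by simpa using h.length_le
    rw [← take_take p hl]
    exact List.prefix_iff_eq_take.1 h
  · intro h
    exact ⟨l.length, by rw [← h]⟩

theorem getElem?_of_prefix {l l' : List ℕ} (h : l <+: l') {i a : ℕ} (hi : l[i]? = some a) :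
    l'[i]? = some a := by
  obtain ⟨hl, rfl⟩ := List.getElem?_eq_some_iff.1 hi
  exact (List.prefix_iff_getElem?.1 h) i hl

theorem Machine.Outputs.exists_getElem? {M : Machine} {p q : Baire} (h : M.Outputs p q) (n : ℕ) :
    ∃ m, (M.step (take p m))[n]? = some (q n) := by
  obtain ⟨m, hm⟩ := h (n + 1)
  exact ⟨m, getElem?_of_prefix hm (by rw [getElem?_take, if_pos n.lt_succ_self])⟩

theorem Machine.Outputs.step_eq {M : Machine} {p q : Baire} (h : M.Outputs p q) (m : ℕ) :
    ∃ n, M.step (take p m) = take q n := by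
  set l := M.step (take p m) with hl
  refine ⟨l.length, prefix_take_iff.1 ⟨l.length, ?_⟩⟩
  obtain ⟨m', hm'⟩ := h l.length
  have h1 : l <+: M.step (take p (max m m')) :=
    M.mono _ _ (take_prefix_take p (le_max_left _ _))
  have h2 : take q l.length <+: M.step (take p (max m m')) :=
    hm'.trans (M.mono _ _ (take_prefix_take p (le_max_right _ _)))
  exact List.prefix_of_prefix_length_le h1 h2 (by simp)

theorem Machine.Outputs.getElem?_eq {M : Machine} {p q : Baire} (h : M.Outputs p q) {m n a : ℕ}
    (ha : (M.step (take p m))[n]? = some a) : a = q n := by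
  obtain ⟨l, hl⟩ := h.step_eq m
  rw [hl, getElem?_take] at ha
  grind

/-! ### Machines from computable approximations -/

/-- The first value of `g` on the prefixes of `w` of length less than `N`. -/
def firstValue (g : List ℕ → ℕ → Option ℕ) (w : List ℕ) (n : ℕ) : ℕ → Option ℕ
  | 0 => none
  | N + 1 => firstValue g w n N <|> g (w.take N) n

/-- The least successful stage does not change when more input is read. This makes the resulting
machine monotone although `g` need not be. -/
theorem firstValue_eq_some {g : List ℕ → ℕ → Option ℕ} {w : List ℕ} {n N a : ℕ} :
    firstValue g w n N = some a ↔
      ∃ i < N, g (w.take i) n = some a ∧ ∀ j < i, g (w.take j) n = none := by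
  have key : ∀ N, firstValue g w n N = none ↔ ∀ i < N, g (w.take i) n = none := by
    intro N
    induction N with
    | zero => simp [firstValue]
    | succ N ih =>
      rw [Nat.forall_lt_succ_right, ← ih]
      simp [firstValue]
  induction N with
  | zero => simp [firstValue]
  | succ N ih =>
    rw [firstValue]
    cases h : firstValue g w n N with
    | none =>
      have h' := (key N).1 h
      constructor
      · intro ha
        exact ⟨N, by omega, by simpa using ha, h'⟩
      · rintro ⟨i, hi, hia, -⟩
        have : i = N := by
          by_contra hne
          rw [h' i (by omega)] at hia
          cases hia
        subst this
        simpa using hia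
    | some b =>
      rw [h] at ih
      constructor
      · intro ha
        obtain ⟨i, hi, hh⟩ := ih.1 (by simpa using ha)
        exact ⟨i, by omega, hh⟩
      · rintro ⟨i, hi, hia, hj⟩
        rcases Nat.lt_succ_iff_lt_or_eq.1 hi with hi | rfl
        · simpa using ih.2 ⟨i, hi, hia, hj⟩
        · rw [(key i).2 hj] at h
          cases h

/-- The values `F 0, F 1, …` up to the first undefined one, but at most `N` of them. -/
def definedPrefix (F : ℕ → Option ℕ) : ℕ → List ℕ
  | 0 => []
  | N + 1 => definedPrefix F N ++ (F (definedPrefix F N).length).toList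

theorem definedPrefix_getElem? {F : ℕ → Option ℕ} {N i a : ℕ}
    (h : (definedPrefix F N)[i]? = some a) : F i = some a := by
  induction N with
  | zero => simp [definedPrefix] at h
  | succ N ih =>
    rw [definedPrefix, List.getElem?_append] at h
    split_ifs at h with hi
    · exact ih h
    · cases hF : F (definedPrefix F N).length with
      | none => simp [hF] at h
      | some b =>
        rw [hF] at h
        have : i - (definedPrefix F N).length = 0 := by
          by_contra hne
          rw [List.getElem?_eq_none (by simp; omega)] at h
          cases h
        have hi' : i = (definedPrefix F N).length := by omega
        rw [this] at h
        rw [hi', hF]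
        simpa using h

theorem length_definedPrefix_le (F : ℕ → Option ℕ) (N : ℕ) : (definedPrefix F N).length ≤ N := by
  induction N with
  | zero => simp [definedPrefix]
  | succ N ih =>
    rw [definedPrefix, List.length_append]
    cases F (definedPrefix F N).length <;> simp <;> omega

theorem le_length_definedPrefix {F : ℕ → Option ℕ} {n N : ℕ} (h : ∀ i < n, F i ≠ none)
    (hN : n ≤ N) : n ≤ (definedPrefix F N).length := by
  have key : ∀ N, min n N ≤ (definedPrefix F N).length := by
    intro N
    induction N with
    | zero => simp
    | succ N ih =>
      rw [definedPrefix, List.length_append]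
      by_cases hn : n ≤ (definedPrefix F N).length
      · omega
      · obtain ⟨a, ha⟩ := Option.ne_none_iff_exists'.1 (h (definedPrefix F N).length (by omega))
        simp [ha]
        omega
  have := key N
  omega

theorem definedPrefix_prefix {F G : ℕ → Option ℕ} {N N' : ℕ} (hN : N ≤ N')
    (h : ∀ i a, F i = some a → G i = some a) : definedPrefix F N <+: definedPrefix G N' := by
  have hF : ∀ i (hi : i < (definedPrefix F N).length), F i = some (definedPrefix F N)[i] :=
    fun i hi => definedPrefix_getElem? (List.getElem?_eq_getElem hi)
  have hl : (definedPrefix F N).length ≤ (definedPrefix G N').length := by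
    refine le_length_definedPrefix (fun i hi => ?_) ((length_definedPrefix_le F N).trans hN)
    rw [h i _ (hF i hi)]
    simp
  rw [List.prefix_iff_getElem?]
  intro i hi
  have h1 := h i _ (hF i hi)
  have h2 := definedPrefix_getElem? (List.getElem?_eq_getElem (hi.trans_le hl))
  rw [List.getElem?_eq_getElem (hi.trans_le hl), ← h2, h1]

theorem computable_of_succ {α σ : Type*} [Primcodable α] [Primcodable σ] {F : α → ℕ → σ}
    {f : α → σ} {h : α → ℕ × σ → σ} (hf : Computable f) (hh : Computable₂ h)
    (h0 : ∀ a, F a 0 = f a) (hs : ∀ a n, F a (n + 1) = h a (n, F a n)) :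
    Computable fun x : α × ℕ => F x.1 x.2 := by
  have key : Computable fun x : α × ℕ =>
      (Nat.rec (f x.1) (fun n s => h x.1 (n, s)) x.2 : σ) :=
    Computable.nat_rec (h := fun (x : α × ℕ) (y : ℕ × σ) => h x.1 y) Computable.snd
      (hf.comp Computable.fst) (hh.comp (Computable.fst.comp Computable.fst) Computable.snd)
  refine key.of_eq fun x => ?_
  induction x.2 with
  | zero => exact (h0 _).symm
  | succ n ih => exact (congrArg (fun s => h x.1 (n, s)) ih).trans (hs _ _).symm

theorem computable_orElse : Computable₂ (fun a b : Option ℕ => (a <|> b)) :=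
  Primrec.option_orElse.to_comp

theorem computable_firstValue {g : List ℕ → ℕ → Option ℕ} (hg : Computable₂ g) :
    Computable fun x : (List ℕ × ℕ) × ℕ => firstValue g x.1.1 x.1.2 x.2 := by
  have h1 : Computable fun y : (List ℕ × ℕ) × (ℕ × Option ℕ) => g (y.1.1.take y.2.1) y.1.2 :=
    hg.comp (Primrec.list_take.to_comp.comp (Computable.fst.comp Computable.snd)
      (Computable.fst.comp Computable.fst)) (Computable.snd.comp Computable.fst)
  have h2 : Computable₂ fun (x : List ℕ × ℕ) (y : ℕ × Option ℕ) =>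
      (y.2 <|> g (x.1.take y.1) x.2) :=
    computable_orElse.comp (Computable.snd.comp Computable.snd) h1
  exact computable_of_succ (F := fun x N => firstValue g x.1 x.2 N)
    (Computable.const none) h2 (fun _ => rfl) (fun _ _ => rfl)

theorem computable_definedPrefix {g : List ℕ → ℕ → Option ℕ} (hg : Computable₂ g) :
    Computable fun x : List ℕ × ℕ =>
      definedPrefix (fun n => firstValue g x.1 n (x.1.length + 1)) x.2 := by
  have hl : Computable fun y : List ℕ × (ℕ × List ℕ) => y.2.2 :=
    Computable.snd.comp Computable.snd
  have h1 : Computable fun y : List ℕ × (ℕ × List ℕ) =>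
      firstValue g y.1 y.2.2.length (y.1.length + 1) :=
    (computable_firstValue hg).comp ((Computable.fst.pair (Computable.list_length.comp hl)).pair
      (Computable.succ.comp (Computable.list_length.comp Computable.fst)))
  have h2 : Computable₂ fun (w : List ℕ) (y : ℕ × List ℕ) =>
      y.2 ++ (firstValue g w y.2.length (w.length + 1)).toList :=
    Computable.list_append.comp hl (Primrec.optionToList.to_comp.comp h1)
  exact computable_of_succ
    (F := fun w N => definedPrefix (fun n => firstValue g w n (w.length + 1)) N)
    (Computable.const []) h2 (fun _ => rfl) (fun _ _ => rfl)

/-- A machine that computes the `n`-th entry of the output by waiting for the first prefix of the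
input for which `g` provides a value. -/
def Machine.ofApprox (g : List ℕ → ℕ → Option ℕ) (hg : Computable₂ g) : Machine where
  step w := definedPrefix (fun n => firstValue g w n (w.length + 1)) w.length
  computable_step := (computable_definedPrefix hg).comp (Computable.id.pair Computable.list_length)
  mono v w h := by
    refine definedPrefix_prefix h.length_le fun n a ha => ?_
    rw [firstValue_eq_some] at ha ⊢
    obtain ⟨i, hi, hia, hj⟩ := ha
    have hl := h.length_le
    have ht : ∀ j ≤ i, w.take j = v.take j := by
      intro j hji
      obtain ⟨u, rfl⟩ := h
      rw [List.take_append_of_le_length (by omega)]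
    exact ⟨i, by omega, by rw [ht i le_rfl, hia], fun j hji => by rw [ht j hji.le, hj j hji]⟩

/-- Different prefixes may give different values of `g`, so each output entry is only known to be
one of them. This suits unbounded searches with several admissible results. -/
theorem Machine.ofApprox_outputs {g : List ℕ → ℕ → Option ℕ} (hg : Computable₂ g) {p : Baire}
    (h : ∀ n, ∃ m, g (take p m) n ≠ none) :
    ∃ q, (Machine.ofApprox g hg).Outputs p q ∧ ∀ n, ∃ m, g (take p m) n = some (q n) := by
  classical
  have h' : ∀ n, ∃ m a, g (take p m) n = some a ∧ ∀ j < m, g (take p j) n = none := by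
    intro n
    obtain ⟨a, ha⟩ := Option.ne_none_iff_exists'.1 (Nat.find_spec (h n))
    exact ⟨_, a, ha, fun j hj => not_not.1 (Nat.find_min (h n) hj)⟩
  choose m q hq hm using h'
  refine ⟨q, fun n => ?_, fun n => ⟨m n, hq n⟩⟩
  obtain ⟨N, hN⟩ : ∃ N, n ≤ N ∧ ∀ i < n, m i ≤ N := by
    refine ⟨n + (Finset.range n).sup m, by omega, fun i hi => ?_⟩
    have := Finset.le_sup (f := m) (Finset.mem_range.2 hi)
    omega
  refine ⟨N, ?_⟩
  have hF : ∀ i < n, firstValue g (take p N) i ((take p N).length + 1) = some (q i) := by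
    intro i hi
    rw [firstValue_eq_some]
    have hmi := hN.2 i hi
    refine ⟨m i, by simp; omega, by rw [take_take p hmi, hq], fun j hj => ?_⟩
    rw [take_take p (hj.le.trans hmi), hm i j hj]
  have hl : n ≤ ((Machine.ofApprox g hg).step (take p N)).length :=
    le_length_definedPrefix (fun i hi => by rw [hF i hi]; simp) (by simpa using hN.1)
  rw [List.prefix_iff_getElem?]
  intro i hi
  have hi' : i < n := by simpa using hi
  have h1 := definedPrefix_getElem? (List.getElem?_eq_getElem (hi'.trans_le hl))
  rw [hF i hi'] at h1
  rw [List.getElem?_eq_getElem (hi'.trans_le hl), ← h1]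
  simp [take]

theorem Machine.ofApprox_outputs_of_forall {g : List ℕ → ℕ → Option ℕ} (hg : Computable₂ g)
    {p q : Baire} (h : ∀ n, ∃ m, g (take p m) n ≠ none)
    (hq : ∀ n m a, g (take p m) n = some a → a = q n) :
    (Machine.ofApprox g hg).Outputs p q := by
  obtain ⟨q', h1, h2⟩ := Machine.ofApprox_outputs hg h
  have : q' = q := funext fun n => by
    obtain ⟨m, hm⟩ := h2 n
    exact hq n m _ hm
  rwa [← this]

/-- Reading a rearrangement of the input is computable. -/
theorem Machine.exists_rearrange {φ : ℕ → ℕ} (hφ : Primrec φ) :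
    ∃ M : Machine, ∀ p, M.Outputs p fun n => p (φ n) := by
  have hg : Computable₂ fun (w : List ℕ) n => w[φ n]? :=
    (Primrec.list_getElem?.comp Primrec.fst (hφ.comp Primrec.snd)).to_comp
  refine ⟨Machine.ofApprox _ hg, fun p => Machine.ofApprox_outputs_of_forall hg (fun n => ?_) ?_⟩
  · exact ⟨φ n + 1, by simp⟩
  · intro n m a ha
    rw [getElem?_take] at ha
    grind

theorem Machine.exists_id : ∃ M : Machine, ∀ p, M.Outputs p p :=
  Machine.exists_rearrange Primrec.id

/-! ### Pairing and composition of machines -/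

@[simp] theorem join_even (p q : Baire) (n : ℕ) : join p q (2 * n) = p n := by
  simp [join]

@[simp] theorem join_odd (p q : Baire) (n : ℕ) : join p q (2 * n + 1) = q n := by
  have : (2 * n + 1) / 2 = n := by omega
  simp [join, this]

theorem Machine.exists_snd : ∃ M : Machine, ∀ p q, M.Outputs (join p q) q := by
  have h : Primrec fun n : ℕ => 2 * n + 1 :=
    Primrec.succ.comp (Primrec.nat_mul.comp (Primrec.const 2) Primrec.id)
  obtain ⟨M, hM⟩ := Machine.exists_rearrange h
  exact ⟨M, fun p q => by simpa using hM (join p q)⟩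

theorem Reducible.refl {X Y : RepresentedSpace} (f : Problem X Y) : Reducible f f := by
  obtain ⟨K, hK⟩ := Machine.exists_id
  obtain ⟨H, hH⟩ := Machine.exists_snd
  exact ⟨K, H, fun p x hx hf => ⟨p, hK p, x, hx, hf, fun s w hw hwx => ⟨s, hH p s, w, hw, hwx⟩⟩⟩

/-- The composition of two machines. -/
def Machine.comp (M N : Machine) : Machine where
  step w := M.step (N.step w)
  computable_step := M.computable_step.comp N.computable_step
  mono _ _ h := M.mono _ _ (N.mono _ _ h)

theorem Machine.comp_outputs {M N : Machine} {p q r : Baire} (hN : N.Outputs p q)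
    (hM : M.Outputs q r) : (M.comp N).Outputs p r := by
  intro n
  obtain ⟨m, hm⟩ := hM n
  obtain ⟨l, hl⟩ := hN m
  exact ⟨l, hm.trans (M.mono _ _ hl)⟩

theorem Machine.exists_join (M N : Machine) : ∃ L : Machine, ∀ p q r, M.Outputs p q →
    N.Outputs p r → L.Outputs p (join q r) := by
  have hd : Computable fun x : List ℕ × ℕ => x.2 / 2 :=
    (Primrec.nat_div.comp Primrec.snd (Primrec.const 2)).to_comp
  have hc : Computable fun x : List ℕ × ℕ => decide (x.2 % 2 = 0) :=
    (Primrec.eq.comp (Primrec.nat_mod.comp Primrec.snd (Primrec.const 2))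
      (Primrec.const 0)).decide.to_comp
  have hg : Computable₂ fun (w : List ℕ) (n : ℕ) =>
      bif decide (n % 2 = 0) then (M.step w)[n / 2]? else (N.step w)[n / 2]? :=
    Computable.cond hc
      (Computable.list_getElem?.comp (M.computable_step.comp Computable.fst) hd)
      (Computable.list_getElem?.comp (N.computable_step.comp Computable.fst) hd)
  refine ⟨Machine.ofApprox _ hg, fun p q r hq hr =>
    Machine.ofApprox_outputs_of_forall hg (fun n => ?_) fun n m a ha => ?_⟩
  · by_cases hn : n % 2 = 0
    · obtain ⟨m, hm⟩ := hq.exists_getElem? (n / 2)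
      exact ⟨m, by simp [hn, hm]⟩
    · obtain ⟨m, hm⟩ := hr.exists_getElem? (n / 2)
      exact ⟨m, by simp [hn, hm]⟩
  · by_cases hn : n % 2 = 0
    · simp only [hn, decide_true, cond_true] at ha
      simp [join, hn, hq.getElem?_eq ha]
    · simp only [hn, decide_false, cond_false] at ha
      simp [join, hn, hr.getElem?_eq ha]

/-- The longest prefix of `⟨p, q⟩` of even length that is determined by prefixes of `p` and `q`. -/
def joinWord (v w : List ℕ) : List ℕ :=
  (List.range (2 * min v.length w.length)).map
    fun i => if i % 2 = 0 then v.getD (i / 2) 0 else w.getD (i / 2) 0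

theorem primrec_joinWord : Primrec₂ joinWord := by
  have hv : Primrec fun x : (List ℕ × List ℕ) × ℕ => x.1.1 := Primrec.fst.comp Primrec.fst
  have hw : Primrec fun x : (List ℕ × List ℕ) × ℕ => x.1.2 := Primrec.snd.comp Primrec.fst
  have hd : Primrec fun x : (List ℕ × List ℕ) × ℕ => x.2 / 2 :=
    Primrec.nat_div.comp Primrec.snd (Primrec.const 2)
  have hc : PrimrecPred fun x : (List ℕ × List ℕ) × ℕ => x.2 % 2 = 0 :=
    Primrec.eq.comp (Primrec.nat_mod.comp Primrec.snd (Primrec.const 2)) (Primrec.const 0)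
  refine Primrec.list_map (Primrec.list_range.comp (Primrec.nat_mul.comp (Primrec.const 2)
    (Primrec.nat_min.comp (Primrec.list_length.comp Primrec.fst)
      (Primrec.list_length.comp Primrec.snd)))) ?_
  exact Primrec.ite hc ((Primrec.list_getD 0).comp hv hd) ((Primrec.list_getD 0).comp hw hd)

theorem joinWord_take (p q : Baire) (m n : ℕ) :
    joinWord (take p m) (take q n) = take (join p q) (2 * min m n) := by
  simp only [joinWord, length_take]
  change _ = (List.range _).map _
  refine List.map_congr_left fun i hi => ?_
  have hi' : i < 2 * min m n := List.mem_range.1 hi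
  simp only [List.getD_eq_getElem?_getD, getElem?_take, join]
  rw [if_pos (show i / 2 < m by omega), if_pos (show i / 2 < n by omega)]
  rfl

/-- Entry 0 is all that matters for a name of a natural number, and it depends on finitely many
symbols of both inputs. -/
theorem getElem?_step_joinWord {H : Machine} {p s q : Baire} (h : H.Outputs (join p s) q) :
    ∃ N, ∀ m n, N ≤ m → N ≤ n → (H.step (joinWord (take p m) (take s n)))[0]? = some (q 0) := by
  obtain ⟨N, hN⟩ := h.exists_getElem? 0
  refine ⟨N, fun m n hm hn => ?_⟩
  rw [joinWord_take]
  exact getElem?_of_prefix (H.mono _ _ (take_prefix_take _ (by omega))) hN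

theorem eq_of_getElem?_step_joinWord {H : Machine} {p s q : Baire}
    (h : H.Outputs (join p s) q) {m n a : ℕ}
    (ha : (H.step (joinWord (take p m) (take s n)))[0]? = some a) : a = q 0 := by
  rw [joinWord_take] at ha
  exact h.getElem?_eq ha

/-! ### Coding optional numbers by numbers -/

/-- The numbers with `0` added as a code of `none`. -/
def optionCode (o : Option ℕ) : ℕ := o.elim 0 Nat.succ

@[simp] theorem optionCode_none : optionCode none = 0 := rfl

@[simp] theorem optionCode_some (a : ℕ) : optionCode (some a) = a + 1 := rfl

theorem primrec_optionCode : Primrec optionCode := by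
  refine (Primrec.option_getD.comp (Primrec.option_map₁ Primrec.succ) (Primrec.const 0)).of_eq
    fun o => ?_
  cases o <;> rfl

theorem optionCode_eq_succ {o : Option ℕ} {n : ℕ} : optionCode o = n + 1 ↔ o = some n := by
  cases o <;> simp

theorem optionCode_ne_zero {o : Option ℕ} : optionCode o ≠ 0 ↔ ∃ n, o = some n := by
  cases o <;> simp

/-- The inverse of `optionCode`. -/
def optionDecode (n : ℕ) : Option ℕ := if n = 0 then none else some (n - 1)

@[simp] theorem optionDecode_zero : optionDecode 0 = none := rfl

@[simp] theorem optionDecode_succ (n : ℕ) : optionDecode (n + 1) = some n := by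
  simp [optionDecode]

theorem optionDecode_eq_some {m n : ℕ} : optionDecode m = some n ↔ m = n + 1 := by
  cases m <;> simp

theorem primrec_optionDecode : Primrec optionDecode :=
  Primrec.ite (Primrec.eq.comp Primrec.id (Primrec.const 0)) (Primrec.const none)
    (Primrec.option_some.comp (Primrec.nat_sub.comp Primrec.id (Primrec.const 1)))

/-! ### The existence of first-order parts -/

/-- Baire space as a represented space. -/
def baireSpace : RepresentedSpace where
  carrier := Baire
  rep p := Part.some p
  surj x := ⟨x, Part.mem_some x⟩

/-- A canonical representative of the first-order part of `f`. An input is a pair `⟨r, t⟩` where `r`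
is a name of an instance of `f` and `t` is the table of a partial function on words that is defined
on some prefix of each name of a solution of this instance; an output is a value of `t` at a
prefix of a name of a solution. -/
def firstOrder {Z W : RepresentedSpace} (f : Problem Z W) : Problem baireSpace natSpace :=
  fun (x : Baire) => {n : ℕ | ∃ z ∈ Z.rep fun i => x (2 * i), z ∈ f.dom ∧
    (∀ s, ∀ w ∈ W.rep s, w ∈ f z → ∃ m, x (2 * Encodable.encode (take s m) + 1) ≠ 0) ∧
    ∃ s, ∃ w ∈ W.rep s, w ∈ f z ∧ ∃ m, x (2 * Encodable.encode (take s m) + 1) = n + 1}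

theorem exists_machine_lookup : ∃ H : Machine, ∀ x s : Baire,
    (∃ m, x (2 * Encodable.encode (take s m) + 1) ≠ 0) →
      ∃ q, H.Outputs (join x s) q ∧ ∃ m, x (2 * Encodable.encode (take s m) + 1) = q 0 + 1 := by
  let odds : List ℕ → List ℕ := fun w =>
    (List.range (w.length / 2)).map fun i => w.getD (2 * i + 1) 0
  have hodds : Primrec odds := by
    refine Primrec.list_map (Primrec.list_range.comp (Primrec.nat_div.comp Primrec.list_length
      (Primrec.const 2))) ?_
    exact (Primrec.list_getD 0).comp Primrec.fst
      (Primrec.succ.comp (Primrec.nat_mul.comp (Primrec.const 2) Primrec.snd))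
  have odds_take : ∀ x s N, odds (take (join x s) N) = take s (N / 2) := by
    intro x s N
    simp only [odds, length_take]
    change _ = (List.range _).map _
    refine List.map_congr_left fun i hi => ?_
    have hi' : i < N / 2 := List.mem_range.1 hi
    rw [List.getD_eq_getElem?_getD, getElem?_take, if_pos (by omega)]
    simp
  -- The length of the input read doubles as a search index: its first unpaired component is the
  -- length of the prefix of `s` to try. Each candidate recurs at arbitrarily large lengths, when
  -- enough of `x` and `s` is known.
  let g : List ℕ → ℕ → Option ℕ := fun w _ =>
    (w[2 * (2 * Encodable.encode ((odds w).take w.length.unpair.1) + 1)]?).bind optionDecode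
  have hg : Computable₂ g := by
    refine (Primrec.option_bind (f := fun x : List ℕ × ℕ =>
      x.1[2 * (2 * Encodable.encode ((odds x.1).take x.1.length.unpair.1) + 1)]?)
      (g := fun _ n => optionDecode n) ?_ (primrec_optionDecode.comp Primrec.snd)).to_comp
    refine Primrec.list_getElem?.comp Primrec.fst (Primrec.nat_mul.comp (Primrec.const 2)
      (Primrec.succ.comp (Primrec.nat_mul.comp (Primrec.const 2) (Primrec.encode.comp ?_))))
    exact Primrec.list_take.comp
      (Primrec.fst.comp (Primrec.unpair.comp (Primrec.list_length.comp Primrec.fst)))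
      (hodds.comp Primrec.fst)
  refine ⟨Machine.ofApprox g hg, fun x s ⟨m, hm⟩ => ?_⟩
  obtain ⟨q, hq, hq'⟩ := Machine.ofApprox_outputs hg (p := join x s) fun n => by
    set c := 2 * Encodable.encode (take s m) + 1 with hc
    refine ⟨Nat.pair m (2 * m + 2 * c + 1), ?_⟩
    have hle := Nat.right_le_pair m (2 * m + 2 * c + 1)
    simp only [g, odds_take, length_take, Nat.unpair_pair]
    rw [take_take _ (by omega), ← hc, getElem?_take, if_pos (by omega), join_even,
      Option.bind_some]
    obtain ⟨a, ha⟩ := Nat.exists_eq_succ_of_ne_zero hm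
    simp [ha]
  refine ⟨q, hq, ?_⟩
  obtain ⟨N, hN⟩ := hq' 0
  simp only [g, odds_take, length_take, Option.bind_eq_some_iff] at hN
  obtain ⟨a, ha, ha'⟩ := hN
  rw [optionDecode_eq_some] at ha'
  rw [getElem?_take] at ha
  split_ifs at ha with hlt
  rw [join_even, Option.some_inj, ha'] at ha
  -- Only `N / 2` entries of `s` are known, so a longer candidate was cut off there.
  refine ⟨min N.unpair.1 (N / 2), ?_⟩
  rw [← ha]
  congr 4
  rcases le_total N.unpair.1 (N / 2) with h | h
  · rw [take_take _ h, min_eq_left h]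
  · rw [min_eq_right h, List.take_of_length_le (by simpa using h)]

/-- Solutions are the table values at all prefixes of all names of solutions, so whichever nonzero
entry the lookup meets is correct. -/
theorem firstOrder_reducible {Z W : RepresentedSpace} (f : Problem Z W) :
    Reducible (firstOrder f) f := by
  obtain ⟨K, hK⟩ := Machine.exists_rearrange (φ := fun n => 2 * n)
    (Primrec.nat_mul.comp (Primrec.const 2) Primrec.id)
  obtain ⟨H, hH⟩ := exists_machine_lookup
  refine ⟨K, H, fun p x hx hdom => ?_⟩
  obtain rfl : x = p := Part.mem_some_iff.1 hx
  obtain ⟨n, z, hz, hzf, hall, -⟩ := hdom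
  refine ⟨_, hK x, z, hz, hzf, fun s w hw hwz => ?_⟩
  obtain ⟨q, hq, m, hm⟩ := hH x s (hall s w hw hwz)
  exact ⟨q, hq, q 0, Part.mem_some _, z, hz, hzf, hall, s, w, hw, hwz, m, hm⟩

/-- This turns the outer witness `H`, with `p` fixed, into data: the table records its first output
symbol on each word, and 0 while there is none. -/
theorem exists_machine_table (H : Machine) : ∃ M : Machine, ∀ p, ∃ t, M.Outputs p t ∧
    ∀ s m, t (Encodable.encode (take s m)) =
      optionCode (H.step (joinWord (take p m) (take s m)))[0]? := by
  let word : ℕ → List ℕ := fun n => (Encodable.decode (α := List ℕ) n).getD []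
  have hword : Primrec word :=
    Primrec.option_getD.comp Primrec.decode (Primrec.const [])
  let T : List ℕ → ℕ → ℕ := fun v n => optionCode (H.step (joinWord (v.take (word n).length)
    (word n)))[0]?
  have hw : Primrec fun x : List ℕ × ℕ => word x.2 := hword.comp Primrec.snd
  have hT : Computable₂ T := by
    refine primrec_optionCode.to_comp.comp (Computable.list_getElem?.comp
      (H.computable_step.comp (primrec_joinWord.to_comp.comp ?_ hw.to_comp)) (Computable.const 0))
    exact (Primrec.list_take.comp (Primrec.list_length.comp hw) Primrec.fst).to_comp
  let g : List ℕ → ℕ → Option ℕ := fun v n =>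
    bif decide ((word n).length ≤ v.length) then some (T v n) else none
  have hg : Computable₂ g := by
    refine Computable.cond ?_ (Computable.option_some.comp hT) (Computable.const none)
    exact (Primrec.nat_le.comp (Primrec.list_length.comp hw)
      (Primrec.list_length.comp Primrec.fst)).decide.to_comp
  refine ⟨Machine.ofApprox g hg, fun p => ⟨fun n => T (take p (word n).length) n, ?_, ?_⟩⟩
  · refine Machine.ofApprox_outputs_of_forall hg (fun n => ⟨(word n).length, by simp [g]⟩) ?_
    intro n m a ha
    by_cases hm : (word n).length ≤ m
    · simp only [g, length_take, hm, decide_true, cond_true, Option.some_inj] at ha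
      rw [← ha]
      simp only [T, take_take p hm, take_take p le_rfl]
    · simp [g, hm] at ha
  · intro s m
    simp [T, word, take_take p le_rfl]

theorem reducible_firstOrder {V Z W : RepresentedSpace} {f : Problem Z W}
    {h : Problem V natSpace} (hf : Reducible h f) : Reducible h (firstOrder f) := by
  obtain ⟨K, H, hKH⟩ := hf
  obtain ⟨M, hM⟩ := exists_machine_table H
  obtain ⟨L, hL⟩ := Machine.exists_join K M
  obtain ⟨S, hS⟩ := Machine.exists_snd
  refine ⟨L, S, fun p x hx hdom => ?_⟩
  obtain ⟨r, hr, z, hz, hzf, hout⟩ := hKH p x hx hdom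
  obtain ⟨t, ht, htable⟩ := hM p
  have hz' : z ∈ Z.rep fun i => join r t (2 * i) := by simpa using hz
  have hall : ∀ s, ∀ w ∈ W.rep s, w ∈ f z →
      ∃ m n, join r t (2 * Encodable.encode (take s m) + 1) = n + 1 := by
    intro s w hw hwz
    obtain ⟨q, hq, -⟩ := hout s w hw hwz
    obtain ⟨N, hN⟩ := getElem?_step_joinWord hq
    exact ⟨N, q 0, by rw [join_odd, htable, hN N N le_rfl le_rfl, optionCode_some]⟩
  have hall' : ∀ s, ∀ w ∈ W.rep s, w ∈ f z →
      ∃ m, join r t (2 * Encodable.encode (take s m) + 1) ≠ 0 := by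
    intro s w hw hwz
    obtain ⟨m, n, h⟩ := hall s w hw hwz
    exact ⟨m, by omega⟩
  refine ⟨join r t, hL p r t hr ht, join r t, Part.mem_some _, ?_, ?_⟩
  · obtain ⟨w, hw⟩ := hzf
    obtain ⟨s, hs⟩ := W.surj w
    obtain ⟨m, n, h⟩ := hall s w hs hw
    exact ⟨n, z, hz', ⟨w, hw⟩, hall', s, w, hs, hw, m, h⟩
  · intro s n hn hsol
    obtain rfl : n = s 0 := Part.mem_some_iff.1 hn
    refine ⟨s, hS p s, s 0, Part.mem_some _, ?_⟩
    obtain ⟨z', hz'', -, -, s', w, hw, hwz, m, hm⟩ := hsol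
    -- The name `r` denotes only one instance, so the table entry found comes from a run of `H` on a
    -- solution of `z` itself.
    obtain rfl : z' = z := Part.mem_unique hz'' hz'
    obtain ⟨q, hq, y, hy, hyx⟩ := hout s' w hw hwz
    obtain rfl : y = q 0 := Part.mem_some_iff.1 hy
    rw [join_odd, htable, optionCode_eq_succ] at hm
    rwa [eq_of_getElem?_step_joinWord hq hm]

theorem isFirstOrderPart_firstOrder {Z W : RepresentedSpace} (f : Problem Z W) :
    IsFirstOrderPart (firstOrder f) f :=
  ⟨firstOrder_reducible f, ⟨_, firstOrder f, Reducible.refl _, Reducible.refl _⟩,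
    fun _ _ => reducible_firstOrder⟩

/-! ### Guessability is inherited by reducible problems with numerical solutions -/

theorem coe_mem_completion {Y : RepresentedSpace} {p : Baire} {y : Y.carrier} :
    ((y : WithBot Y.carrier) : (completion Y).carrier) ∈ (completion Y).rep p ↔
      {i | p i ≠ 0}.Infinite ∧ y ∈ Y.rep (strip p) := by
  classical
  change (y : WithBot Y.carrier) ∈ Part.some _ ↔ _
  rw [Part.mem_some_iff]
  constructor
  · intro h
    split_ifs at h with hd
    · rw [WithBot.coe_inj] at h
      exact ⟨hd.1, h ▸ Part.get_mem hd.2⟩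
    · exact absurd h WithBot.coe_ne_bot
  · rintro ⟨h1, h2⟩
    rw [dif_pos ⟨h1, h2.1⟩, WithBot.coe_inj, Part.get_eq_of_mem h2]

theorem mem_power {Y : RepresentedSpace} {k : ℕ} {p : Baire} {y : (power Y k).carrier} :
    y ∈ (power Y k).rep p ↔ ∀ i : Fin k, y i ∈ Y.rep fun n => p (Nat.pair i n) := by
  constructor
  · rintro ⟨h, rfl⟩ i
    exact Part.get_mem (h i)
  · intro h
    exact ⟨fun i => (h i).1, funext fun i => Part.get_eq_of_mem (h i) (h i).1⟩

theorem completion_rep_dom {Y : RepresentedSpace} (p : Baire) : ((completion Y).rep p).Dom :=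
  trivial

/-- The part of the word `u` that belongs to the `i`-th component of a tuple of names in a
completion, with the zeros deleted and the other entries decreased by one. -/
def component (i : ℕ) (u : List ℕ) : List ℕ :=
  (List.range u.length).filterMap fun n => (u[Nat.pair i n]?).bind optionDecode

theorem primrec_component : Primrec₂ component := by
  refine Primrec.listFilterMap (Primrec.list_range.comp (Primrec.list_length.comp Primrec.snd)) ?_
  refine Primrec.option_bind (f := fun x : (ℕ × List ℕ) × ℕ => x.1.2[Nat.pair x.1.1 x.2]?)
    (g := fun _ n => optionDecode n) ?_ (primrec_optionDecode.comp Primrec.snd)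
  exact Primrec.list_getElem?.comp (Primrec.snd.comp Primrec.fst)
    (Primrec₂.natPair.comp (Primrec.fst.comp Primrec.fst) Primrec.snd)

theorem filterMap_range_eq_take_strip {p : Baire} (M : ℕ) :
    (List.range M).filterMap (fun n => optionDecode (p n)) =
      take (strip p) (Nat.count (fun n => p n ≠ 0) M) := by
  induction M with
  | zero => simp [take]
  | succ M ih =>
    rw [List.range_succ, List.filterMap_append, ih, Nat.count_succ]
    by_cases h : p M = 0
    · simp [h]
    · rw [if_pos h, take_succ, strip, Nat.nth_count (p := fun n => p n ≠ 0) h]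
      simp [optionDecode, h]

/-- As `Nat.pair i` is strictly increasing, the entries of component `i` visible in a prefix of `q`
form an initial segment, without gaps; `M` is its length. -/
theorem component_take (q : Baire) (i N : ℕ) : ∃ M, (∀ l, Nat.pair i l ≤ N → l ≤ M) ∧
    component i (take q N) = take (strip fun n => q (Nat.pair i n))
      (Nat.count (fun n => q (Nat.pair i n) ≠ 0) M) := by
  have key : ∀ L, ∃ M, (M = L ∨ N ≤ Nat.pair i M) ∧ M ≤ L ∧ (∀ n < M, Nat.pair i n < N) ∧
      (List.range L).filterMap (fun n => ((take q N)[Nat.pair i n]?).bind optionDecode) =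
        (List.range M).filterMap (fun n => optionDecode (q (Nat.pair i n))) := by
    intro L
    induction L with
    | zero => exact ⟨0, Or.inl rfl, le_rfl, by simp, rfl⟩
    | succ L ih =>
      obtain ⟨M, h1, h2, h3, h4⟩ := ih
      by_cases hL : Nat.pair i L < N
      · have hM : M = L := by
          rcases h1 with h1 | h1
          · exact h1
          · by_contra hne
            have := Nat.pair_lt_pair_right i (lt_of_le_of_ne h2 hne)
            omega
        subst hM
        refine ⟨M + 1, Or.inl rfl, le_rfl, fun n hn => ?_, ?_⟩
        · rcases Nat.lt_succ_iff_lt_or_eq.1 hn with hn | rfl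
          · exact h3 n hn
          · exact hL
        · rw [List.range_succ, List.filterMap_append, List.filterMap_append, h4]
          simp only [List.filterMap_cons, List.filterMap_nil, getElem?_take, if_pos hL,
            Option.bind_some]
      · refine ⟨M, Or.inr ?_, by omega, h3, ?_⟩
        · rcases h1 with rfl | h1
          · omega
          · exact h1
        · rw [List.range_succ, List.filterMap_append, h4]
          simp [getElem?_take, hL]
  obtain ⟨M, h1, -, -, h4⟩ := key N
  refine ⟨M, fun l hl => ?_, ?_⟩
  · rcases h1 with rfl | h1
    · exact (Nat.right_le_pair i l).trans hl
    · by_contra hlt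
      have := Nat.pair_lt_pair_right i (not_le.1 hlt)
      omega
  · rw [component, length_take, h4, filterMap_range_eq_take_strip]

theorem exists_component_take {q : Baire} {i : ℕ}
    (h : {n | q (Nat.pair i n) ≠ 0}.Infinite) (l : ℕ) : ∃ N₀, ∀ N ≥ N₀, ∃ n ≥ l,
      component i (take q N) = take (strip fun n => q (Nat.pair i n)) n := by
  refine ⟨Nat.pair i (Nat.nth (fun n => q (Nat.pair i n) ≠ 0) l), fun N hN => ?_⟩
  obtain ⟨M, hM, hc⟩ := component_take q i N
  refine ⟨_, ?_, hc⟩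
  calc l = Nat.count (fun n => q (Nat.pair i n) ≠ 0)
        (Nat.nth (fun n => q (Nat.pair i n) ≠ 0) l) := (Nat.count_nth_of_infinite h l).symm
    _ ≤ _ := Nat.count_monotone _ (hM _ hN)

theorem Machine.Outputs.exists_step_eq {M : Machine} {p q : Baire} (h : M.Outputs p q) (l : ℕ) :
    ∃ m₀, ∀ m ≥ m₀, ∃ n ≥ l, M.step (take p m) = take q n := by
  obtain ⟨m₀, hm₀⟩ := h l
  refine ⟨m₀, fun m hm => ?_⟩
  obtain ⟨n, hn⟩ := h.step_eq m
  refine ⟨n, ?_, hn⟩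
  have := (hm₀.trans (M.mono _ _ (take_prefix_take p hm))).length_le
  simpa [hn] using this

/-- Every guess of `G` is fed to `H`. While `H` has no answer a 0 is written, which the completion
treats as padding, so wrong guesses cannot block the output. -/
theorem exists_machine_guess (G H : Machine) : ∃ M : Machine, ∀ p, ∃ Q, M.Outputs p Q ∧
    ∀ i n, Q (Nat.pair i n) = optionCode
      (H.step (joinWord (take p n) (component i (G.step (take p n)))))[0]? := by
  let T : List ℕ → ℕ → ℕ := fun v m => optionCode
    (H.step (joinWord (v.take m.unpair.2)
      (component m.unpair.1 (G.step (v.take m.unpair.2)))))[0]?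
  have hu : Computable fun x : List ℕ × ℕ => x.2.unpair := Computable.unpair.comp Computable.snd
  have hv : Computable fun x : List ℕ × ℕ => x.1.take x.2.unpair.2 :=
    Primrec.list_take.to_comp.comp (Computable.snd.comp hu) Computable.fst
  have hT : Computable₂ T := by
    refine primrec_optionCode.to_comp.comp (Computable.list_getElem?.comp
      (H.computable_step.comp (primrec_joinWord.to_comp.comp hv
        (primrec_component.to_comp.comp (Computable.fst.comp hu) (G.computable_step.comp hv))))
      (Computable.const 0))
  let g : List ℕ → ℕ → Option ℕ := fun v m =>
    bif decide (m.unpair.2 ≤ v.length) then some (T v m) else none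
  have hg : Computable₂ g := by
    refine Computable.cond ?_ (Computable.option_some.comp hT) (Computable.const none)
    exact (Primrec.nat_le.comp (Primrec.snd.comp (Primrec.unpair.comp Primrec.snd))
      (Primrec.list_length.comp Primrec.fst)).decide.to_comp
  refine ⟨Machine.ofApprox g hg, fun p => ⟨fun m => T (take p m.unpair.2) m, ?_, ?_⟩⟩
  · refine Machine.ofApprox_outputs_of_forall hg (fun n => ⟨n.unpair.2, by simp [g]⟩) ?_
    intro n m a ha
    by_cases hm : n.unpair.2 ≤ m
    · simp only [g, length_take, hm, decide_true, cond_true, Option.some_inj] at ha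
      rw [← ha]
      simp only [T, take_take p hm, take_take p le_rfl]
    · simp [g, hm] at ha
  · intro i n
    simp [T, take_take p le_rfl]

/-- On a correct guess `H` answers eventually, and the same answer is then repeated forever. The
component thus has infinitely many nonzero entries and names that number. -/
theorem Guessable.of_reducible {V X Y : RepresentedSpace} {h : Problem V natSpace}
    {d : Problem X Y} {k : ℕ} (hd : Guessable k d) (hr : Reducible h d) : Guessable k h := by
  obtain ⟨G, hG⟩ := hd
  obtain ⟨K, H, hKH⟩ := hr
  obtain ⟨M, hM⟩ := exists_machine_guess (G.comp K) H
  refine ⟨M, fun p x hx hdom => ?_⟩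
  obtain ⟨r, hr, z, hz, hzd, hout⟩ := hKH p x hx hdom
  obtain ⟨q, hq, y, hy, i, v, hv, hyv⟩ := hG r z hz hzd
  have hGK : (G.comp K).Outputs p q := Machine.comp_outputs hr hq
  have hi := mem_power.1 hy i
  rw [hyv] at hi
  obtain ⟨hinf, hstrip⟩ := coe_mem_completion.1 hi
  obtain ⟨q₀, hq₀, a, ha, hax⟩ := hout _ v hstrip hv
  obtain rfl : a = q₀ 0 := Part.mem_some_iff.1 ha
  obtain ⟨Q, hMQ, hQ⟩ := hM p
  have hval : ∀ n, Q (Nat.pair i n) ≠ 0 → Q (Nat.pair i n) = q₀ 0 + 1 := by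
    intro n hn
    rw [hQ] at hn ⊢
    obtain ⟨b, hb⟩ := optionCode_ne_zero.1 hn
    obtain ⟨c, hc⟩ := hGK.step_eq n
    obtain ⟨e, -, he⟩ := component_take q i c
    rw [hb]
    rw [hc, he] at hb
    rw [optionCode_some, eq_of_getElem?_step_joinWord hq₀ hb]
  have hlarge : ∃ n₀, ∀ n ≥ n₀, Q (Nat.pair i n) ≠ 0 := by
    obtain ⟨N, hN⟩ := getElem?_step_joinWord hq₀
    obtain ⟨N₁, hN₁⟩ := exists_component_take hinf N
    obtain ⟨m₀, hm₀⟩ := hGK.exists_step_eq N₁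
    refine ⟨max m₀ N, fun n hn => ?_⟩
    obtain ⟨c, hc, hc'⟩ := hm₀ n (le_of_max_le_left hn)
    obtain ⟨e, he, he'⟩ := hN₁ c hc
    rw [hQ, hc', he', hN n e (le_of_max_le_right hn) he]
    simp
  have hinf' : {n | Q (Nat.pair i n) ≠ 0}.Infinite := by
    obtain ⟨n₀, hn₀⟩ := hlarge
    exact (Set.Ici_infinite n₀).mono fun n hn => hn₀ n hn
  -- Whatever the other components contain, they name something, because the representation of the
  -- completion is total.
  refine ⟨Q, hMQ, fun j => ((completion natSpace).rep _).get (completion_rep_dom _),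
    mem_power.2 fun j => Part.get_mem _, i, q₀ 0, hax, ?_⟩
  refine Part.get_eq_of_mem (coe_mem_completion.2 ⟨hinf', ?_⟩) _
  refine Part.mem_some_iff.2 ?_
  have := hval _ (Nat.nth_mem_of_infinite hinf' 0)
  change q₀ 0 = Q (Nat.pair i (Nat.nth _ 0)) - 1
  rw [this, Nat.add_sub_cancel]

/-! ### Finding antichains in a solution of the tree pigeonhole principle -/

/-- The first `N` entries of the list `A` are pairwise incomparable for the prefix order. -/
def IsAntichainList (N : ℕ) (A : List (List Bool)) : Prop :=
  ∀ i < N, ∀ j < N, A.getD i [] <+: A.getD j [] → i = j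

/-- Given a colouring that is constant on some cone, find a colour and an antichain of size `N`
such that the colour occurs infinitely often above each point of the antichain. -/
def antichainProblem (N : ℕ) : Problem (colourings 2) natSpace :=
  fun (c : List Bool → Fin 2) => {n : ℕ | (∃ ρ a, ∀ τ, c (ρ ++ τ) = a) ∧
    ∃ (a : Fin 2) (A : List (List Bool)), n = Encodable.encode ((a : ℕ), A) ∧
      IsAntichainList N A ∧ ∀ i < N, {τ | A.getD i [] <+: τ ∧ c τ = a}.Infinite}

theorem primrecRel_prefix : PrimrecRel fun σ τ : List Bool => σ <+: τ := by
  refine PrimrecPred.of_eq (p := fun x : List Bool × List Bool => x.1 = x.2.take x.1.length)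
    (Primrec.eq.comp Primrec.fst (Primrec.list_take.comp
      (Primrec.list_length.comp Primrec.fst) Primrec.snd)) fun x => ?_
  exact List.prefix_iff_eq_take.symm

theorem primrecPred_forall_lt_const {α : Type*} [Primcodable α] {R : ℕ → α → Prop}
    (hR : PrimrecRel R) (N : ℕ) : PrimrecPred fun a => ∀ i < N, R i a :=
  ((PrimrecRel.forall_mem_list hR).comp (Primrec.const (List.range N)) Primrec.id).of_eq
    fun a => by simp

theorem primrecPred_isAntichainList (N : ℕ) : PrimrecPred (IsAntichainList N) := by
  have h : PrimrecRel fun (j : ℕ) (x : ℕ × List (List Bool)) =>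
      x.2.getD x.1 [] <+: x.2.getD j [] → x.1 = j := by
    refine PrimrecPred.of_eq (p := fun y : ℕ × ℕ × List (List Bool) =>
      (¬ y.2.2.getD y.2.1 [] <+: y.2.2.getD y.1 []) ∨ y.2.1 = y.1) ?_ fun y => imp_iff_not_or.symm
    have hA : Primrec fun y : ℕ × ℕ × List (List Bool) => y.2.2 := Primrec.snd.comp Primrec.snd
    have hi : Primrec fun y : ℕ × ℕ × List (List Bool) => y.2.1 := Primrec.fst.comp Primrec.snd
    exact (primrecRel_prefix.comp ((Primrec.list_getD []).comp hA hi)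
      ((Primrec.list_getD []).comp hA Primrec.fst)).not.or (Primrec.eq.comp hi Primrec.fst)
  exact primrecPred_forall_lt_const
    (R := fun i (A : List (List Bool)) => ∀ j < N, A.getD i [] <+: A.getD j [] → i = j)
    (primrecPred_forall_lt_const h N) N

theorem exists_machine_antichain (N : ℕ) : ∃ H : Machine, ∀ p s : Baire,
    (∃ A, IsAntichainList N A ∧ ∀ i < N, s (Encodable.encode (A.getD i [])) = 1) →
      ∃ q, H.Outputs (join p s) q ∧ ∃ A, IsAntichainList N A ∧
        (∀ i < N, s (Encodable.encode (A.getD i [])) = 1) ∧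
        q 0 = Encodable.encode (p (Encodable.encode (A.getD 0 [])), A) := by
  classical
  let P : List ℕ → List (List Bool) → Prop := fun w A => IsAntichainList N A ∧
    ∀ i < N, w[2 * Encodable.encode (A.getD i []) + 1]? = some 1
  have hP : PrimrecRel P := by
    have h : PrimrecRel fun (i : ℕ) (x : List ℕ × List (List Bool)) =>
        x.1[2 * Encodable.encode (x.2.getD i []) + 1]? = some 1 := by
      refine Primrec.eq.comp (Primrec.list_getElem?.comp (Primrec.fst.comp Primrec.snd)
        (Primrec.succ.comp (Primrec.nat_mul.comp (Primrec.const 2)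
          (Primrec.encode.comp ?_)))) (Primrec.const (some 1))
      exact (Primrec.list_getD []).comp (Primrec.snd.comp Primrec.snd) Primrec.fst
    exact ((primrecPred_isAntichainList N).comp Primrec.snd).and
      (primrecPred_forall_lt_const h N)
  let val : List ℕ → List (List Bool) → Option ℕ := fun w A =>
    if P w A then (w[2 * Encodable.encode (A.getD 0 [])]?).map fun a => Encodable.encode (a, A)
    else none
  have hval : Primrec₂ val := by
    refine Primrec.ite hP (Primrec.option_map (Primrec.list_getElem?.comp Primrec.fst
      (Primrec.nat_mul.comp (Primrec.const 2) (Primrec.encode.comp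
        ((Primrec.list_getD []).comp Primrec.snd (Primrec.const 0))))) ?_) (Primrec.const none)
    exact Primrec.encode.comp (Primrec.snd.pair (Primrec.snd.comp Primrec.fst))
  -- The input length again encodes the candidate, here a list `A`, so that every list is tried at
  -- arbitrarily late stages.
  let g : List ℕ → ℕ → Option ℕ := fun w _ =>
    (Encodable.decode (α := List (List Bool)) w.length.unpair.1).bind (val w)
  have hg : Computable₂ g := by
    refine (Primrec.option_bind (f := fun x : List ℕ × ℕ =>
      Encodable.decode (α := List (List Bool)) x.1.length.unpair.1)
      (g := fun x A => val x.1 A) ?_ ?_).to_comp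
    · exact Primrec.decode.comp (Primrec.fst.comp (Primrec.unpair.comp
        (Primrec.list_length.comp Primrec.fst)))
    · exact hval.comp (Primrec.fst.comp Primrec.fst) Primrec.snd
  refine ⟨Machine.ofApprox g hg, fun p s ⟨A, hA, hs⟩ => ?_⟩
  obtain ⟨q, hq, hq'⟩ := Machine.ofApprox_outputs hg (p := join p s) fun n => by
    obtain ⟨B, hB⟩ : ∃ B, 2 * Encodable.encode (A.getD 0 []) < B ∧
        ∀ i < N, 2 * Encodable.encode (A.getD i []) + 1 < B := by
      refine ⟨2 * Encodable.encode (A.getD 0 []) +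
        2 * (Finset.range N).sup (fun i => Encodable.encode (A.getD i [])) + 2,
        by omega, fun i hi => ?_⟩
      have := Finset.le_sup (f := fun i => Encodable.encode (A.getD i [])) (Finset.mem_range.2 hi)
      omega
    have hle := Nat.right_le_pair (Encodable.encode A) B
    refine ⟨Nat.pair (Encodable.encode A) B, ?_⟩
    have hPA : P (take (join p s) (Nat.pair (Encodable.encode A) B)) A := by
      refine ⟨hA, fun i hi => ?_⟩
      rw [getElem?_take, if_pos ((hB.2 i hi).trans_le hle), join_odd, hs i hi]
    simp only [g, val, length_take, Nat.unpair_pair, Encodable.encodek, Option.bind_some,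
      if_pos hPA]
    rw [getElem?_take, if_pos (hB.1.trans_le hle)]
    simp
  refine ⟨q, hq, ?_⟩
  obtain ⟨m, hm⟩ := hq' 0
  simp only [g, Option.bind_eq_some_iff] at hm
  obtain ⟨A', -, hA'⟩ := hm
  simp only [val] at hA'
  split_ifs at hA' with hPA
  obtain ⟨a, ha, ha'⟩ := Option.map_eq_some_iff.1 hA'
  have entry : ∀ i b, (take (join p s) m)[i]? = some b → join p s i = b := by
    intro i b hb
    rw [getElem?_take] at hb
    split_ifs at hb
    simpa using hb
  refine ⟨A', hPA.1, fun i hi => ?_, ?_⟩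
  · have := entry _ _ (hPA.2 i hi)
    rwa [join_odd] at this
  · have := entry _ _ ha
    rw [join_even] at this
    rw [← ha', this]

/-- Being a prefix means being equal or lying in the left or right subtree, so both readings can be
treated through the order. -/
theorem IsTreeCopy.exists_orderEmbedding {L : TreeLanguage} {H : Set (List Bool)}
    (h : IsTreeCopy L H) : ∃ e : List Bool → List Bool, Function.Injective e ∧
      Set.range e = H ∧ ∀ σ τ, e σ <+: e τ ↔ σ <+: τ := by
  have strict : ∀ σ τ : List Bool, σ <+: τ ↔ σ = τ ∨ ∃ b, σ ++ [b] <+: τ := by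
    intro σ τ
    constructor
    · rintro ⟨_ | ⟨b, u⟩, rfl⟩
      · simp
      · exact Or.inr ⟨b, u, by simp⟩
    · rintro (rfl | ⟨b, hb⟩)
      · exact List.prefix_rfl
      · exact (List.prefix_append _ _).trans hb
  cases L with
  | order => exact h
  | leftRight =>
    obtain ⟨e, he, hr, hlr⟩ := h
    refine ⟨e, he, hr, fun σ τ => ?_⟩
    rw [strict, strict σ, he.eq_iff]
    simp only [hlr]

theorem isTreeCopy_cone (L : TreeLanguage) (ρ : List Bool) :
    IsTreeCopy L (Set.range fun τ => ρ ++ τ) := by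
  cases L with
  | order => exact ⟨_, List.append_right_injective ρ, rfl, fun σ τ => by simp⟩
  | leftRight => exact ⟨_, List.append_right_injective ρ, rfl, fun b σ τ => by simp⟩

theorem eq_of_replicate_prefix {i j : ℕ}
    (h : List.replicate i true ++ [false] <+: List.replicate j true ++ [false]) : i = j := by
  have hl : i ≤ j := by simpa using h.length_le
  by_contra hne
  have h1 := List.prefix_iff_getElem?.1 h i (by simp)
  rw [List.getElem?_append_left (by simp; omega)] at h1
  simp [lt_of_le_of_ne hl hne] at h1

/-- The strings 1^i 0 are pairwise incomparable, hence so are their images in a copy, and the search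
succeeds. Above each point of a copy lie infinitely many others. Positivity of `N` ensures that the
point where the colour is read lies in the copy. -/
theorem antichainProblem_reducible_TT (L : TreeLanguage) {N : ℕ} (hN : 0 < N) :
    Reducible (antichainProblem N) (TT L 2) := by
  obtain ⟨K, hK⟩ := Machine.exists_id
  obtain ⟨M, hM⟩ := exists_machine_antichain N
  refine ⟨K, M, fun p c hc hdom => ⟨p, hK p, c, hc, ?_, fun s H hH hsol => ?_⟩⟩
  · obtain ⟨n, ⟨ρ, a, hρ⟩, -⟩ := hdom
    -- The promised constant cone is itself a monochromatic copy, so solvability needs no pigeonhole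
    -- theorem for trees.
    refine ⟨_, isTreeCopy_cone L ρ, a, ?_⟩
    rintro _ ⟨τ, rfl⟩
    exact hρ τ
  · obtain ⟨n, hcone, -⟩ := hdom
    obtain ⟨hcopy, a, ha⟩ := hsol
    obtain ⟨e, he, hr, hpre⟩ := hcopy.exists_orderEmbedding
    obtain ⟨hs, rfl⟩ := hH
    obtain ⟨hp, rfl⟩ := hc
    have hmem : ∀ σ, s (Encodable.encode (e σ)) = 1 := by
      intro σ
      have hσ : e σ ∈ Set.range e := ⟨σ, rfl⟩
      rw [hr] at hσ
      exact hσ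
    obtain ⟨q, hq, A, hA, hAs, hqA⟩ := hM p s
      ⟨(List.range N).map fun i => e (List.replicate i true ++ [false]), fun i hi j hj hij => by
        simp only [List.getD_eq_getElem?_getD, List.getElem?_map, List.getElem?_range hi,
          List.getElem?_range hj, Option.map_some, Option.getD_some, hpre] at hij
        exact eq_of_replicate_prefix hij, fun i hi => by
        simp [List.getD_eq_getElem?_getD, List.getElem?_range hi, hmem]⟩
    refine ⟨q, hq, q 0, Part.mem_some _, hcone, a, A, ?_, hA, fun i hi => ?_⟩
    · rw [hqA, ← ha (A.getD 0 []) (hAs 0 hN)]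
      rfl
    · obtain ⟨σ, hσ⟩ : A.getD i [] ∈ Set.range e := by
        rw [hr]
        exact hAs i hi
      refine Set.infinite_of_injective_forall_mem
        (f := fun n : ℕ => e (σ ++ List.replicate n true)) (fun m n hmn => ?_) fun n => ⟨?_, ?_⟩
      · simpa using congrArg List.length (List.append_right_injective σ (he hmn))
      · rw [← hσ, hpre]
        exact List.prefix_append _ _
      · exact ha _ (hmem _)

/-! ### The antichain problem is not guessable -/

/-- Choose a longest string σ in the union as the representative of its antichain. The prefixes of σ
form a chain, so deleting them costs every other antichain at most one point, and induction applies.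
No remaining string is a prefix of σ, and by maximal length σ is a prefix of none. -/
theorem exists_incomparable_representatives {ι : Type*} (n : ℕ) (J : Finset ι)
    (A : ι → Finset (List Bool)) (hJ : J.card = n) (hA : ∀ i ∈ J, n ≤ (A i).card)
    (hanti : ∀ i ∈ J, ∀ σ ∈ A i, ∀ τ ∈ A i, σ <+: τ → σ = τ) :
    ∃ f : ι → List Bool, (∀ i ∈ J, f i ∈ A i) ∧ ∀ i ∈ J, ∀ j ∈ J, f i <+: f j → i = j := by
  classical
  induction n generalizing J A with
  | zero =>
    obtain rfl := Finset.card_eq_zero.1 hJ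
    exact ⟨fun _ => [], by simp, by simp⟩
  | succ n ih =>
    have hne : (J.biUnion A).Nonempty := by
      obtain ⟨i, hi⟩ : J.Nonempty := Finset.card_pos.1 (by omega)
      obtain ⟨σ, hσ⟩ : (A i).Nonempty := Finset.card_pos.1 (by have := hA i hi; omega)
      exact ⟨σ, Finset.mem_biUnion.2 ⟨i, hi, hσ⟩⟩
    obtain ⟨σ, hσ, hmax⟩ := Finset.exists_max_image _ List.length hne
    obtain ⟨i, hi, hσi⟩ := Finset.mem_biUnion.1 hσ
    obtain ⟨f, hf, hf'⟩ := ih (J.erase i) (fun j => (A j).filter fun τ => ¬ τ <+: σ)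
      (by rw [Finset.card_erase_of_mem hi, hJ]; rfl)
      (fun j hj => by
        have hj' := Finset.mem_of_mem_erase hj
        have h1 : ((A j).filter fun τ => τ <+: σ).card ≤ 1 := by
          refine Finset.card_le_one.2 fun τ hτ υ hυ => ?_
          rw [Finset.mem_filter] at hτ hυ
          rcases List.prefix_or_prefix_of_prefix hτ.2 hυ.2 with h | h
          · exact hanti j hj' τ hτ.1 υ hυ.1 h
          · exact (hanti j hj' υ hυ.1 τ hτ.1 h).symm
        have h2 := Finset.card_filter_add_card_filter_not (s := A j) (fun τ => τ <+: σ)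
        have h3 := hA j hj'
        omega)
      (fun j hj τ hτ υ hυ => hanti j (Finset.mem_of_mem_erase hj) τ (Finset.mem_filter.1 hτ).1
        υ (Finset.mem_filter.1 hυ).1)
    have hfj : ∀ j ∈ J, j ≠ i → f j ∈ A j ∧ ¬ f j <+: σ := fun j hj hji =>
      Finset.mem_filter.1 (hf j (Finset.mem_erase.2 ⟨hji, hj⟩))
    refine ⟨Function.update f i σ, fun j hj => ?_, fun j hj l hl h => ?_⟩
    · by_cases hji : j = i
      · subst hji
        simpa using hσi
      · simpa [hji] using (hfj j hj hji).1
    · by_cases hji : j = i <;> by_cases hli : l = i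
      · rw [hji, hli]
      · subst hji
        simp only [Function.update_self, Function.update_of_ne hli] at h
        obtain ⟨h1, h2⟩ := hfj l hl hli
        have hle := hmax (f l) (Finset.mem_biUnion.2 ⟨l, hl, h1⟩)
        exact absurd (h.eq_of_length_le hle ▸ List.prefix_rfl) h2
      · subst hli
        simp only [Function.update_self, Function.update_of_ne hji] at h
        exact absurd h (hfj j hj hji).2
      · simp only [Function.update_of_ne hji, Function.update_of_ne hli] at h
        exact hf' j (Finset.mem_erase.2 ⟨hji, hj⟩) l (Finset.mem_erase.2 ⟨hli, hl⟩) h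

theorem finite_encode_lt (m : ℕ) : {σ : List Bool | Encodable.encode σ < m}.Finite :=
  (Set.finite_Iio m).preimage Encodable.encode_injective.injOn

/-- Finitely many strings have a code below `m`; lengthening ρ beyond all of them removes the
exceptions. -/
theorem exists_cone_of_eventually {c : List Bool → Fin 2} {m : ℕ} {ρ : List Bool} {a : Fin 2}
    (h : ∀ τ, m ≤ Encodable.encode (ρ ++ τ) → c (ρ ++ τ) = a) :
    ∃ ρ' a', ∀ τ, c (ρ' ++ τ) = a' := by
  obtain ⟨l, hl⟩ := ((finite_encode_lt m).image List.length).bddAbove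
  refine ⟨ρ ++ List.replicate (l + 1) true, a, fun τ => ?_⟩
  rw [List.append_assoc]
  refine h _ ?_
  by_contra hlt
  have := hl ⟨_, not_le.1 hlt, rfl⟩
  simp at this
  omega

/-- A finite part of a colouring can be continued such that finitely many given numbers are not
solutions of the antichain problem. -/
theorem exists_colouring_avoiding {ι : Type*} {N : ℕ} {J : Finset ι} (hJ : J.card ≤ N)
    (val : ι → ℕ) (c : List Bool → Fin 2) (m : ℕ) : ∃ c' : List Bool → Fin 2,
      (∀ σ, Encodable.encode σ < m → c' σ = c σ) ∧ (∃ ρ a, ∀ τ, c' (ρ ++ τ) = a) ∧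
      ∀ i ∈ J, ¬ ∃ (a : Fin 2) (A : List (List Bool)),
        val i = Encodable.encode ((a : ℕ), A) ∧ IsAntichainList N A ∧
          ∀ j < N, {τ | A.getD j [] <+: τ ∧ c' τ = a}.Infinite := by
  classical
  -- A number that does not encode a colour with an antichain is never a solution, so only the valid
  -- ones must be defeated.
  let valid : ι → Prop := fun i => ∃ (a : Fin 2) (A : List (List Bool)),
    val i = Encodable.encode ((a : ℕ), A) ∧ IsAntichainList N A
  have hv : ∀ i, ∃ (a : Fin 2) (A : List (List Bool)), valid i →
      val i = Encodable.encode ((a : ℕ), A) ∧ IsAntichainList N A := by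
    intro i
    by_cases h : valid i
    · obtain ⟨a, A, h⟩ := h
      exact ⟨a, A, fun _ => h⟩
    · exact ⟨0, [], fun h' => absurd h' h⟩
  choose a A hA using hv
  let I := J.filter valid
  have hI : ∀ i ∈ I, IsAntichainList N (A i) := fun i hi => (hA i (Finset.mem_filter.1 hi).2).2
  obtain ⟨f, hf, hf'⟩ := exists_incomparable_representatives I.card I
    (fun i => (Finset.range N).image fun j => (A i).getD j []) rfl
    (fun i hi => by
      rw [Finset.card_image_of_injOn, Finset.card_range]
      · exact (Finset.card_filter_le _ _).trans hJ
      · intro j hj l hl h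
        have h' : (A i).getD j [] = (A i).getD l [] := h
        exact hI i hi j (by simpa using hj) l (by simpa using hl) (h' ▸ List.prefix_rfl))
    (fun i hi σ hσ τ hτ h => by
      obtain ⟨j, hj, rfl⟩ := Finset.mem_image.1 hσ
      obtain ⟨l, hl, rfl⟩ := Finset.mem_image.1 hτ
      rw [hI i hi j (Finset.mem_range.1 hj) l (Finset.mem_range.1 hl) h])
  -- From code `m` on, the cone above `f i` gets the colour opposite to `a i`. Incomparability of
  -- the `f i` makes these cones disjoint, so the demands do not conflict.
  let c' : List Bool → Fin 2 := fun τ => if Encodable.encode τ < m then c τ else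
    if ∃ i ∈ I, f i <+: τ ∧ a i = 0 then 1 else 0
  have hc' : ∀ i ∈ I, ∀ τ, f i <+: τ → m ≤ Encodable.encode τ → c' τ = 1 - a i := by
    intro i hi τ hτ hm
    have huniq : (∃ i' ∈ I, f i' <+: τ ∧ a i' = 0) ↔ a i = 0 := by
      constructor
      · rintro ⟨i', hi', h1, h2⟩
        have : i' = i := by
          rcases List.prefix_or_prefix_of_prefix h1 hτ with h | h
          · exact hf' i' hi' i hi h
          · exact (hf' i hi i' hi' h).symm
        rwa [← this]
      · exact fun h => ⟨i, hi, hτ, h⟩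
    simp only [c', if_neg (not_lt.2 hm), huniq]
    generalize a i = b
    fin_cases b <;> rfl
  refine ⟨c', fun σ hσ => if_pos hσ, ?_, fun i hiJ => ?_⟩
  · rcases I.eq_empty_or_nonempty with h | ⟨i, hi⟩
    · refine exists_cone_of_eventually (m := m) (ρ := []) (a := 0) fun τ hτ => ?_
      simp only [c', if_neg (not_lt.2 hτ), h]
      simp
    · exact exists_cone_of_eventually fun τ hτ => hc' i hi _ (List.prefix_append _ _) hτ
  · rintro ⟨b, B, hb, hB, hinf⟩
    have hi : valid i := ⟨b, B, hb, hB⟩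
    have hiI : i ∈ I := Finset.mem_filter.2 ⟨hiJ, hi⟩
    have heq := Encodable.encode_injective (hb.symm.trans (hA i hi).1)
    rw [Prod.mk.injEq, Fin.val_inj] at heq
    obtain ⟨rfl, rfl⟩ := heq
    obtain ⟨j, hj, hfj⟩ := Finset.mem_image.1 (hf i hiI)
    refine hinf j (Finset.mem_range.1 hj) ((finite_encode_lt m).subset ?_)
    rintro τ ⟨h1, h2⟩
    by_contra hlt
    rw [hfj] at h1
    rw [hc' i hiI τ h1 (not_lt.1 hlt)] at h2
    generalize a i = b at h2
    fin_cases b <;> simp at h2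

/-! ### Diagonalisation against finitely many guesses -/

open Classical in
/-- The canonical name of a colouring with two colours. -/
noncomputable def colouringName (c : List Bool → Fin 2) : Baire :=
  fun n => if ∃ σ, Encodable.encode σ = n ∧ c σ = 1 then 1 else 0

theorem mem_rep_colouringName (c : List Bool → Fin 2) :
    (c : (colourings 2).carrier) ∈ (colourings 2).rep (colouringName c) := by
  have h : ∀ σ, colouringName c (Encodable.encode σ) = (c σ : ℕ) := by
    intro σ
    simp only [colouringName, Encodable.encode_inj, exists_eq_left]
    generalize c σ = b
    fin_cases b <;> simp
  exact ⟨fun σ => h σ ▸ (c σ).2, funext fun σ => Fin.ext (h σ)⟩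

theorem take_colouringName_congr {c c' : List Bool → Fin 2} {m : ℕ}
    (h : ∀ σ, Encodable.encode σ < m → c' σ = c σ) :
    take (colouringName c') m = take (colouringName c) m := by
  refine List.map_congr_left fun n hn => ?_
  have hn' := List.mem_range.1 hn
  have : (∃ σ, Encodable.encode σ = n ∧ c' σ = 1) ↔ ∃ σ, Encodable.encode σ = n ∧ c σ = 1 := by
    refine exists_congr fun σ => and_congr_right fun hσ => ?_
    rw [h σ (hσ ▸ hn')]
  unfold colouringName
  split_ifs with h1 h2 h2
  · rfl
  · exact absurd (this.1 h1) h2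
  · exact absurd (this.2 h2) h1
  · rfl

/-- The first nonzero entry of the `i`-th component of `u` is `v + 1`. -/
def Decides (u : List ℕ) (i v : ℕ) : Prop :=
  ∃ n, u[Nat.pair i n]? = some (v + 1) ∧ ∀ l < n, u[Nat.pair i l]? = some 0

theorem Decides.mono {u u' : List ℕ} {i v : ℕ} (h : Decides u i v) (hu : u <+: u') :
    Decides u' i v := by
  obtain ⟨n, h1, h2⟩ := h
  exact ⟨n, getElem?_of_prefix hu h1, fun l hl => getElem?_of_prefix hu (h2 l hl)⟩

/-- A guess in the completion of ℕ is fixed irrevocably by its first nonzero entry. -/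
theorem Decides.strip_eq {q : Baire} {N i v : ℕ} (h : Decides (take q N) i v) :
    strip (fun n => q (Nat.pair i n)) 0 = v := by
  obtain ⟨n, h1, h2⟩ := h
  have entry : ∀ j b, (take q N)[j]? = some b → q j = b := by
    intro j b hb
    rw [getElem?_take] at hb
    split_ifs at hb
    simpa using hb
  have hn := entry _ _ h1
  have hcount : Nat.count (fun n => q (Nat.pair i n) ≠ 0) n = 0 :=
    Nat.count_iff_forall_not.2 fun l hl => not_not.2 (entry _ _ (h2 l hl))
  have hnth := Nat.nth_count (p := fun n => q (Nat.pair i n) ≠ 0) (n := n) (by omega)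
  rw [hcount] at hnth
  rw [strip, hnth, hn, Nat.add_sub_cancel]

theorem exists_decides {q : Baire} {i : ℕ} (h : {n | q (Nat.pair i n) ≠ 0}.Infinite) :
    ∃ N v, Decides (take q N) i v := by
  classical
  have hex : ∃ n, q (Nat.pair i n) ≠ 0 := h.nonempty
  obtain ⟨v, hv⟩ := Nat.exists_eq_succ_of_ne_zero (Nat.find_spec hex)
  refine ⟨Nat.pair i (Nat.find hex) + 1, v, Nat.find hex, ?_, fun l hl => ?_⟩
  · rw [getElem?_take, if_pos (Nat.lt_succ_self _), hv]
  · have := Nat.pair_lt_pair_right i hl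
    rw [getElem?_take, if_pos (by omega), not_not.1 (Nat.find_min hex hl)]

theorem antichainProblem_dom {N : ℕ} {c : List Bool → Fin 2}
    (h : ∃ ρ a, ∀ τ, c (ρ ++ τ) = a) : c ∈ (antichainProblem N).dom := by
  obtain ⟨ρ, a, hρ⟩ := h
  refine ⟨_, ⟨ρ, a, hρ⟩, a,
    (List.range N).map fun i => ρ ++ (List.replicate i true ++ [false]), rfl,
    fun i hi j hj hij => ?_, fun i hi => ?_⟩
  · simp only [List.getD_eq_getElem?_getD, List.getElem?_map, List.getElem?_range hi,
      List.getElem?_range hj, Option.map_some, Option.getD_some,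
      List.prefix_append_right_inj] at hij
    exact eq_of_replicate_prefix hij
  · simp only [List.getD_eq_getElem?_getD, List.getElem?_map, List.getElem?_range hi,
      Option.map_some, Option.getD_some]
    refine Set.infinite_of_injective_forall_mem
      (f := fun n : ℕ => ρ ++ (List.replicate i true ++ [false]) ++ List.replicate n true)
      (fun m n hmn => ?_) fun n => ⟨List.prefix_append _ _, ?_⟩
    · simpa using congrArg List.length hmn
    · rw [List.append_assoc]
      exact hρ _

theorem not_guessable_antichainProblem {k N : ℕ} (hN : k ≤ N) :
    ¬ Guessable k (antichainProblem N) := by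
  classical
  rintro ⟨M, hM⟩
  -- After j rounds, a finite part of some colouring has forced j components to fix their guesses.
  have key : ∀ j, ∃ (c : List Bool → Fin 2) (m : ℕ) (J : Finset (Fin k)) (val : Fin k → ℕ),
      J.card = j ∧ ∀ i ∈ J, Decides (M.step (take (colouringName c) m)) i (val i) := by
    intro j
    induction j with
    | zero => exact ⟨fun _ => 0, 0, ∅, fun _ => 0, rfl, by simp⟩
    | succ j ih =>
      obtain ⟨c, m, J, val, hJ, hdec⟩ := ih
      have hJN : J.card ≤ N := (Finset.card_le_univ J).trans (by simpa using hN)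
      obtain ⟨c', hcc', hcone, havoid⟩ := exists_colouring_avoiding hJN val c m
      obtain ⟨q, hq, y, hy, i, v, hv, hyv⟩ :=
        hM _ c' (mem_rep_colouringName c') (antichainProblem_dom hcone)
      have hi := mem_power.1 hy i
      rw [hyv] at hi
      obtain ⟨hinf, hstrip⟩ := coe_mem_completion.1 hi
      obtain rfl : v = strip (fun n => q (Nat.pair i n)) 0 := Part.mem_some_iff.1 hstrip
      have hold : ∀ l ∈ J, Decides (M.step (take (colouringName c') m)) l (val l) := by
        rw [take_colouringName_congr hcc']
        exact hdec
      -- The new colouring keeps the first `m` entries of the name, so the guesses in `J` stand and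
      -- are all wrong for it; the correct component is new.
      have hiJ : i ∉ J := by
        intro hiJ
        have hd := hold i hiJ
        obtain ⟨b, hb⟩ := hq.step_eq m
        rw [hb] at hd
        rw [hd.strip_eq] at hv
        exact havoid i hiJ hv.2
      obtain ⟨B, v, hBv⟩ := exists_decides hinf
      obtain ⟨m', hm'⟩ := hq B
      refine ⟨c', max m m', insert i J, Function.update val i v, ?_, fun l hl => ?_⟩
      · rw [Finset.card_insert_of_notMem hiJ, hJ]
      · by_cases hli : l = i
        · subst hli
          rw [Function.update_self]
          exact hBv.mono (hm'.trans (M.mono _ _ (take_prefix_take _ (le_max_right _ _))))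
        · rw [Function.update_of_ne hli]
          exact (hold l (Finset.mem_of_mem_insert_of_ne hl hli)).mono
            (M.mono _ _ (take_prefix_take _ (le_max_left _ _)))
  obtain ⟨-, -, J, -, hJ, -⟩ := key (k + 1)
  have := Finset.card_le_univ J
  rw [Fintype.card_fin] at this
  omega

end Weihrauch

theorem corollary18 (L : Weihrauch.TreeLanguage) :
    (∃ (X : Weihrauch.RepresentedSpace) (d : Weihrauch.Problem X Weihrauch.natSpace),
      Weihrauch.IsFirstOrderPart d (Weihrauch.TT L 2)) ∧
    ∀ (X Y : Weihrauch.RepresentedSpace) (d : Weihrauch.Problem X Y),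
      Weihrauch.IsFirstOrderPart d (Weihrauch.TT L 2) → ∀ k : ℕ, ¬ Weihrauch.Guessable k d := by
  refine ⟨⟨_, _, Weihrauch.isFirstOrderPart_firstOrder _⟩, fun X Y d hd k hk => ?_⟩
  -- Size `k + 1` instead of `k` keeps the antichain nonempty when `k = 0`.
  have hred := hd.2.2 _ _ (Weihrauch.antichainProblem_reducible_TT L k.succ_pos)
  exact Weihrauch.not_guessable_antichainProblem k.le_succ (hk.of_reducible hred)
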